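/- Let $q$ be a prime power, let $\operatorname{Tr}$ and $\operatorname{N}$ be the trace and norm from $\mathbb{F}_{q^3}$ to $\mathbb{F}_q$, let $\theta$ be a primitive element of $\mathbb{F}_{q^3}$ (a generator of $\mathbb{F}_{q^3}^*$), and let $x_1,\dots,x_{q^3}$ be the elements of $\mathbb{F}_{q^3}$ in any order. Let $C_O\subseteq \mathbb{F}_q^{q^3+1}$ be the linear code spanned by the rows of the $8\times(q^3+1)$ matrix \[ G_O=\begin{bmatrix} g(x_1) & g(x_2) & \cdots & g(x_{q^3}) & e_8\end{bmatrix}, \] where $e_8=(0,0,0,0,0,0,0,1)^\top$ and \[ g(x)=\bigl(1,\operatorname{Tr}(x),\operatorname{Tr}(\theta x),\operatorname{Tr}(\theta^2x),\operatorname{Tr}(x^{q+q^2}),\operatorname{Tr}(\theta x^{q+q^2}),\operatorname{Tr}(\theta^2x^{q+q^2}),\operatorname{N}(x)\bigr)^\top , \] and let $C_O^\perp$ be its dual code with respect to the standard dot product on $\mathbb{F}_q^{q^3+1}$. Theorem. The code $C_O^\perp$ has length $q^3+1$, dimension $q^3-7$, and minimum distance (the minimum Hamming weight of a nonzero codeword)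 exactly $d$, where \[ d=\begin{cases}9&\text{for } q=2,\\ 6&\text{for } q=3,\\ 5&\text{for } q\ge 4.\end{cases} \] Moreover, the number of codewords of Hamming weight $5$ in $C_O^\perp$ is \[ \frac{1}{120}(q-3)(q-2)(q-1)\,q^3\,(q^6-1). \] -/

import Mathlib

/-- The Hamming weights of the nonzero words of a linear code `C`. -/
def nonzeroWeights {K : Type*} [Field K] [DecidableEq K] {n : ℕ}
    (C : Submodule K (Fin n → K)) : Set ℕ :=
  {w | ∃ c ∈ C, c ≠ 0 ∧ hammingNorm c = w}

/-- `C`, a subspace of `K ^ n`, is an `[n, k, d]` code over `K`: it has dimension `k`, and `d` is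
exactly the minimum Hamming weight of its nonzero words. (The length `n` is part of the type.) -/
def IsCodeWithParams {K : Type*} [Field K] [DecidableEq K] {n : ℕ}
    (C : Submodule K (Fin n → K)) (k d : ℕ) : Prop :=
  Module.finrank K C = k ∧ IsLeast (nonzeroWeights C) d

/-- The dual code: all words orthogonal to every word of `C` for the standard dot product. -/
def dualCode {K : Type*} [Field K] {n : ℕ} (C : Submodule K (Fin n → K)) :
    Submodule K (Fin n → K) :=
  C.orthogonalBilin (dotProductBilin K K)

/-- With `q = |K|` and `N`, `Tr` the norm and trace of `L` over `K`, the column vector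
`g(x) = (1, Tr x, Tr (θ x), Tr (θ² x), Tr (x ^ (q + q²)), Tr (θ x ^ (q + q²)),
Tr (θ² x ^ (q + q²)), N x)`. -/
noncomputable def ovoidColumn (K : Type*) {L : Type*} [Field K] [Fintype K] [Field L] [Algebra K L]
    (θ x : L) : Fin 8 → K :=
  let q := Fintype.card K
  ![1,
    Algebra.trace K L x,
    Algebra.trace K L (θ * x),
    Algebra.trace K L (θ ^ 2 * x),
    Algebra.trace K L (x ^ (q + q ^ 2)),
    Algebra.trace K L (θ * x ^ (q + q ^ 2)),
    Algebra.trace K L (θ ^ 2 * x ^ (q + q ^ 2)),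
    Algebra.norm K x]

/-- The matrix `G_O = [g(x 0) g(x 1) ⋯ g(x (m - 1)) e₈]` with `8` rows and `m + 1` columns. -/
noncomputable def ovoidMatrix (K : Type*) {L : Type*} [Field K] [Fintype K] [Field L] [Algebra K L]
    (θ : L) {m : ℕ} (x : Fin m → L) : Matrix (Fin 8) (Fin (m + 1)) K :=
  Matrix.of fun i j =>
    Fin.snoc (α := fun _ => Fin 8 → K) (fun l => ovoidColumn K θ (x l)) (Pi.single 7 1) j i

/-- The code `C_O` generated by the rows of `G_O`. -/
noncomputable def ovoidCode (K : Type*) {L : Type*} [Field K] [Fintype K] [Field L] [Algebra K L]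
    (θ : L) {m : ℕ} (x : Fin m → L) : Submodule K (Fin (m + 1) → K) :=
  Submodule.span K (Set.range (ovoidMatrix K θ x).row)

/-! Write `q = |K|` and let `σ` be the Frobenius of `L` over `K`. The columns of the matrix are
indexed by the points of the projective line over `L`. Up to a change of basis, the column at a
point with coordinate vector `v` is the tensor `v ⊗ σ(v) ⊗ σ²(v)`: its entries `1`, `x`,
`σ(x)σ²(x)`, `N(x)` and their conjugates are what the eight rows record. So dual words are the
linear relations among these tensors (`mem_tensorRelations_iff`, `comp_mem_dualCode_iff`).

Pairing a relation with three linear forms, one per tensor factor, erases any three chosen points.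
Hence no nonzero relation has weight at most 4 (`tensorRelation_eq_zero`). In a relation of weight
5, erasing three points leaves two terms; comparing two such identities shows that the cross-ratios
of the support are fixed by `σ`, so they lie in `K` (`crossRatio_mem_range`). Conversely, the
tensors of a subline over `K` form a twisted cubic in a 3-space, so any five of them satisfy a
relation (`exists_tensorRelation`), unique up to scalar by the weight bound.

Weight-5 words with ordered support thus correspond to an ordered triple of points, two distinct
cross-ratios in `K` other than 0 and 1, and a nonzero scalar (`card_weight_five`). The count is
positive for `q ≥ 4` and zero for `q = 3`, where an explicit word has weight 6. For `q = 2` the dual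
code is spanned by the all-ones word. -/

/-! ### The projective line and cross-ratios. -/

/-- Homogeneous coordinates of the points of the projective line over `L`. -/
def homog {L : Type*} [Field L] : Option L → L × L
  | none => (0, 1)
  | some x => (1, x)

/-- The determinant of a vector and a point of the projective line. -/
def bracket {L : Type*} [Field L] (u : L × L) (p : Option L) : L :=
  u.1 * (homog p).2 - u.2 * (homog p).1

theorem bracket_homog_eq_zero {L : Type*} [Field L] {p r : Option L} :
    bracket (homog p) r = 0 ↔ p = r := by
  cases p <;> cases r <;> simp [bracket, homog, sub_eq_zero, eq_comm]

theorem bracket_homog_self {L : Type*} [Field L] (p : Option L) : bracket (homog p) p = 0 :=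
  bracket_homog_eq_zero.2 rfl

theorem bracket_homog_ne_zero {L : Type*} [Field L] {p r : Option L} (h : p ≠ r) :
    bracket (homog p) r ≠ 0 :=
  fun h' => h (bracket_homog_eq_zero.1 h')

theorem bracket_homog_swap {L : Type*} [Field L] (p r : Option L) :
    bracket (homog p) r = -bracket (homog r) p := by
  simp only [bracket]; ring

/-- The three-term Plücker relation: three vectors in a plane are linearly dependent, here expanded
in the basis given by `a` and `b`. -/
theorem bracket_plucker {L : Type*} [Field L] (u : L × L) (a b p : Option L) :
    bracket (homog a) b * bracket u p =
      bracket (homog p) b * bracket u a + bracket (homog a) p * bracket u b := by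
  simp only [bracket]; ring

/-- The coordinate of `p` in which `a`, `d`, `b` become `0`, `1`, `∞`. -/
def crossRatio {L : Type*} [Field L] (a d b p : Option L) : L :=
  bracket (homog d) b * bracket (homog a) p / (bracket (homog a) d * bracket (homog p) b)

theorem crossRatio_zero {L : Type*} [Field L] (a d b : Option L) : crossRatio a d b a = 0 := by
  simp [crossRatio, bracket_homog_self]

theorem crossRatio_one {L : Type*} [Field L] {a d b : Option L} (had : a ≠ d) (hdb : d ≠ b) :
    crossRatio a d b d = 1 := by
  rw [crossRatio, mul_comm]
  exact div_self (mul_ne_zero (bracket_homog_ne_zero had) (bracket_homog_ne_zero hdb))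

theorem crossRatio_injOn {L : Type*} [Field L] {a d b : Option L} (had : a ≠ d) (hdb : d ≠ b)
    (hab : a ≠ b) {p r : Option L} (hp : p ≠ b) (hr : r ≠ b)
    (h : crossRatio a d b p = crossRatio a d b r) : p = r := by
  have h1 := bracket_homog_ne_zero had
  have h2 := bracket_homog_ne_zero hdb
  have h3 := bracket_homog_ne_zero hab
  have h4 := bracket_homog_ne_zero hp
  have h5 := bracket_homog_ne_zero hr
  simp only [crossRatio] at h
  rw [div_eq_div_iff (mul_ne_zero h1 h4) (mul_ne_zero h1 h5)] at h
  have h6 : bracket (homog a) p * bracket (homog r) b =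
      bracket (homog a) r * bracket (homog p) b := by
    apply mul_left_cancel₀ (mul_ne_zero h1 h2)
    linear_combination h
  rw [← bracket_homog_eq_zero]
  apply (mul_eq_zero.1 _).resolve_left h3
  have := bracket_plucker (homog p) a b r
  rw [bracket_homog_swap p a] at this
  linear_combination this - h6

theorem exists_crossRatio_eq {L : Type*} [Field L] [Fintype L] {a d b : Option L} (had : a ≠ d)
    (hdb : d ≠ b) (hab : a ≠ b) (t : L) : ∃ p, p ≠ b ∧ crossRatio a d b p = t := by
  classical
  have : Function.Bijective fun p : {p // p ≠ b} => crossRatio a d b p.1 := by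
    rw [Fintype.bijective_iff_injective_and_card]
    refine ⟨fun p r h => Subtype.ext (crossRatio_injOn had hdb hab p.2 r.2 h), ?_⟩
    simp [Fintype.card_subtype_compl]
  obtain ⟨p, hp⟩ := this.2 t
  exact ⟨p.1, p.2, hp⟩

/-! ### Relations among the tensors: weight bound and rationality of cross-ratios. -/

/-- The words `c` with `∑ c(p) v ⊗ σ(v) ⊗ σ²(v) = 0`, where `v` is the coordinate vector of `p`. -/
def tensorRelations (K : Type*) {L : Type*} [Field K] [Field L] [Algebra K L] [Fintype L]
    (σ : L ≃ₐ[K] L) : Submodule K (Option L → K) where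
  carrier := {c | ∀ u v w : L × L, ∑ p, algebraMap K L (c p) *
    (bracket u p * σ (bracket v p) * σ (σ (bracket w p))) = 0}
  zero_mem' := by simp
  add_mem' := by
    intro c d hc hd u v w
    simp [add_mul, Finset.sum_add_distrib, hc u v w, hd u v w]
  smul_mem' := by
    intro k c hc u v w
    rw [← mul_zero (algebraMap K L k), ← hc u v w, Finset.mul_sum]
    exact Finset.sum_congr rfl fun p _ => by simp [mul_assoc]

theorem mem_tensorRelations {K L : Type*} [Field K] [Field L] [Algebra K L] [Fintype L]
    {σ : L ≃ₐ[K] L} {c : Option L → K} :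
    c ∈ tensorRelations K σ ↔ ∀ u v w : L × L, ∑ p, algebraMap K L (c p) *
      (bracket u p * σ (bracket v p) * σ (σ (bracket w p))) = 0 :=
  Iff.rfl

section

variable {K L : Type*} [Field K] [Field L] [Algebra K L] [Fintype L] {σ : L ≃ₐ[K] L}
  {c : Option L → K}

/-- The form `bracket (homog a)` vanishes at `a`, so using `a`, `b`, `d` in the three slots erases
those points. They need not differ from `e` or `f`. -/
theorem tensorRelation_pair (hc : c ∈ tensorRelations K σ) {a b d e f : Option L} (hef : e ≠ f)
    (h : ∀ p, p ≠ a → p ≠ b → p ≠ d → p ≠ e → p ≠ f → c p = 0) :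
    algebraMap K L (c e) * (bracket (homog a) e * σ (bracket (homog b) e) *
        σ (σ (bracket (homog d) e))) +
      algebraMap K L (c f) * (bracket (homog a) f * σ (bracket (homog b) f) *
        σ (σ (bracket (homog d) f))) = 0 := by
  rw [← hc (homog a) (homog b) (homog d)]
  symm
  apply Finset.sum_eq_add e f hef
  · rintro p - ⟨hpe, hpf⟩
    by_cases hpa : p = a
    · simp [hpa, bracket_homog_self]
    by_cases hpb : p = b
    · simp [hpb, bracket_homog_self]
    by_cases hpd : p = d
    · simp [hpd, bracket_homog_self]
    simp [h p hpa hpb hpd hpe hpf]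
  · simp
  · simp

theorem tensorRelation_eq_zero (hL : 4 ≤ Fintype.card L) (hc : c ∈ tensorRelations K σ)
    (s : Finset (Option L)) (hs : s.card ≤ 4) (h : ∀ p ∉ s, c p = 0) : c = 0 := by
  classical
  by_contra hne
  obtain ⟨e, he⟩ := Function.ne_iff.1 hne
  have hes : e ∈ s := by
    by_contra h'
    exact he (h e h')
  -- Pad the rest of the support to exactly three points, all different from `e`, to be erased
  -- together.
  obtain ⟨t, hst, htu, ht⟩ := Finset.exists_subsuperset_card_eq
    (s := s.erase e) (t := Finset.univ.erase e) (n := 3)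
    (Finset.erase_subset_erase _ (Finset.subset_univ _))
    (by rw [Finset.card_erase_of_mem hes]; omega)
    (by rw [Finset.card_erase_of_mem (Finset.mem_univ _), Finset.card_univ, Fintype.card_option]
        omega)
  obtain ⟨a, b, d, -, -, -, rfl⟩ := Finset.card_eq_three.1 ht
  have hne' : ∀ p ∈ ({a, b, d} : Finset (Option L)), p ≠ e := fun p hp =>
    (Finset.mem_erase.1 (htu hp)).1
  have hae := bracket_homog_ne_zero (hne' a (by simp))
  have hbe := bracket_homog_ne_zero (hne' b (by simp))
  have hde := bracket_homog_ne_zero (hne' d (by simp))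
  -- With `f := a` the second term is already erased, so only the term at `e` survives.
  have := tensorRelation_pair hc (a := a) (b := b) (d := d) (e := e) (f := a)
    (hne' a (by simp)).symm (by
      intro p hpa hpb hpd hpe _
      apply h
      intro hps
      have := hst (Finset.mem_erase.2 ⟨hpe, hps⟩)
      simp [hpa, hpb, hpd] at this)
  simp [bracket_homog_self, hae, hbe, hde] at this
  exact he this

theorem five_le_card_support [DecidableEq K] (hL : 4 ≤ Fintype.card L)
    (hc : c ∈ tensorRelations K σ) (hne : c ≠ 0) :
    5 ≤ hammingNorm c := by
  by_contra! h
  apply hne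
  apply tensorRelation_eq_zero hL hc (Finset.univ.filter fun p => c p ≠ 0)
  · exact Nat.le_of_lt_succ h
  · simp

/-- Erasing `a`, `b`, `e` leaves a relation between the terms at `p` and `d`. Exchanging `a` and `b`
between the first two slots gives a second one; eliminating the coefficients and the third slot
equates the cross-ratio with its image under `σ`. -/
theorem crossRatio_mem_range (hfix : ∀ x : L, σ x = x → x ∈ Set.range (algebraMap K L))
    (hc : c ∈ tensorRelations K σ) {a b d p e : Option L} (had : a ≠ d)
    (hbd : b ≠ d) (hed : e ≠ d) (hap : a ≠ p) (hbp : b ≠ p) (hep : e ≠ p) (hpd : p ≠ d)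
    (h : ∀ x, x ≠ a → x ≠ b → x ≠ d → x ≠ p → x ≠ e → c x = 0) (hcp : c p ≠ 0) (hcd : c d ≠ 0) :
    crossRatio a d b p ∈ Set.range (algebraMap K L) := by
  have h1 := tensorRelation_pair hc (a := a) (b := b) (d := e) hpd
    (fun x _ _ _ _ _ => h x ‹_› ‹_› ‹_› ‹_› ‹_›)
  have h2 := tensorRelation_pair hc (a := b) (b := a) (d := e) hpd
    (fun x _ _ _ _ _ => h x ‹_› ‹_› ‹_› ‹_› ‹_›)
  have had' := bracket_homog_ne_zero had
  have hbd' := bracket_homog_ne_zero hbd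
  have hed' := bracket_homog_ne_zero hed
  have hap' := bracket_homog_ne_zero hap
  have hbp' := bracket_homog_ne_zero hbp
  have hep' := bracket_homog_ne_zero hep
  have hcr : crossRatio a d b p = bracket (homog b) d * bracket (homog a) p /
      (bracket (homog a) d * bracket (homog b) p) := by
    rw [crossRatio, bracket_homog_swap d b, bracket_homog_swap p b, mul_neg, neg_mul, neg_div_neg_eq]
  rw [hcr]
  apply hfix
  have hs : ∀ {y : L}, y ≠ 0 → σ y ≠ 0 := fun h => by simpa using h
  simp only [map_div₀, map_mul]
  rw [div_eq_div_iff (mul_ne_zero (hs had') (hs hbp')) (mul_ne_zero had' hbp')]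
  have hcp' : algebraMap K L (c p) ≠ 0 := by simpa using hcp
  have hcd' : algebraMap K L (c d) ≠ 0 := by simpa using hcd
  apply mul_left_cancel₀ (mul_ne_zero (mul_ne_zero hcp' hcd')
    (mul_ne_zero (hs (hs hep')) (hs (hs hed'))))
  linear_combination (algebraMap K L (c d) * σ (σ (bracket (homog e) d)) *
      bracket (homog a) d * σ (bracket (homog b) d)) * h2 -
    (algebraMap K L (c d) * σ (σ (bracket (homog e) d)) *
      bracket (homog b) d * σ (bracket (homog a) d)) * h1

end

/-! ### Relations supported on five points of a subline. -/

section

variable {K L : Type*} [Field K] [Field L] [Algebra K L] [Fintype L] {σ : L ≃ₐ[K] L}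

/-- In the coordinate where `a`, `d`, `b` are 0, 1, ∞, the tensor at a `K`-rational point `y` is a
cubic polynomial in `y`, up to a scalar that is a norm and so lies in `K`. The third divided
difference at 0, 1, `s`, `t` returns the leading coefficient of a cubic, which is the tensor at ∞.
-/
theorem exists_tensorRelation
    (hN : ∀ x : L, ∃ n : K, algebraMap K L n = x * σ x * σ (σ x)) {a d b p r : Option L}
    (had : a ≠ d) (hab : a ≠ b) (hdb : d ≠ b) (hpa : p ≠ a) (hpb : p ≠ b)
    (hra : r ≠ a) (hrb : r ≠ b) {s t : K} (hs0 : s ≠ 0) (hs1 : s ≠ 1)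
    (ht0 : t ≠ 0) (ht1 : t ≠ 1) (hst : s ≠ t) (hs : crossRatio a d b p = algebraMap K L s)
    (ht : crossRatio a d b r = algebraMap K L t) :
    ∃ c ∈ tensorRelations K σ, c a ≠ 0 ∧
      ∀ x, x ≠ a → x ≠ d → x ≠ b → x ≠ p → x ≠ r → c x = 0 := by
  classical
  choose n hn using hN
  have hn0 : ∀ {x : L}, x ≠ 0 → n x ≠ 0 := by
    intro x hx h
    have := hn x
    simp [h, hx] at this
  have hab' := bracket_homog_ne_zero hab
  have had' := bracket_homog_ne_zero had
  have hdb' := bracket_homog_ne_zero hdb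
  -- `κ x` and `ρ` are the scale factors between the fixed coordinate vectors and the normalised
  -- ones `A + y B`, or `B` at infinity.
  set κ : Option L → L := fun x => bracket (homog x) b / bracket (homog d) b with hκ
  have hκ0 : ∀ {x}, x ≠ b → κ x ≠ 0 := fun h => div_ne_zero (bracket_homog_ne_zero h) hdb'
  set ρ : L := bracket (homog a) b / bracket (homog a) d
  have hρ0 : ρ ≠ 0 := div_ne_zero hab' had'
  set A : L × L → L := fun u => bracket (homog d) b * bracket u a / bracket (homog a) b with hA
  set B : L × L → L := fun u => bracket (homog a) d * bracket u b / bracket (homog a) b with hB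
  have hform : ∀ (u : L × L) (x : Option L), x ≠ b →
      bracket u x = κ x * (A u + crossRatio a d b x * B u) := by
    intro u x hx
    have hxb := bracket_homog_ne_zero hx
    have h := bracket_plucker u a b x
    simp only [hκ, hA, hB, crossRatio]
    field_simp
    linear_combination h
  have hformb : ∀ u : L × L, bracket u b = ρ * B u := by
    intro u
    simp only [ρ, hB]
    field_simp
  have hb : n ρ ≠ 0 := hn0 hρ0
  have ha' := hn0 (hκ0 hab)
  -- Divided-difference weights: the inverse of the product of differences from each node to the
  -- other three. They annihilate 1, `y`, `y²` and send `y³` to 1.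
  set μa : K := (-(s * t))⁻¹
  set μd : K := ((s - 1) * (t - 1))⁻¹
  set μp : K := (s * (s - 1) * (s - t))⁻¹
  set μr : K := (-(t * (t - 1) * (s - t)))⁻¹
  have e1 := sub_ne_zero.2 hs1
  have e2 := sub_ne_zero.2 ht1
  have e3 := sub_ne_zero.2 hst
  have m0 : μa + μd + μp + μr = 0 := by
    simp only [μa, μd, μp, μr]
    field_simp
    ring
  have m1 : μd + μp * s + μr * t = 0 := by
    simp only [μd, μp, μr]
    field_simp
    ring
  have m2 : μd + μp * s ^ 2 + μr * t ^ 2 = 0 := by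
    simp only [μd, μp, μr]
    field_simp
    ring
  have m3 : μd + μp * s ^ 3 + μr * t ^ 3 = 1 := by
    simp only [μd, μp, μr]
    field_simp
    ring
  refine ⟨Pi.single a (μa / n (κ a)) + Pi.single d (μd / n (κ d)) + Pi.single p (μp / n (κ p)) +
    Pi.single r (μr / n (κ r)) + Pi.single b (-1 / n ρ), ?_, ?_, ?_⟩
  · intro u v w
    have key : ∀ (x : Option L) (μ : K), x ≠ b → ∀ y : K, crossRatio a d b x = algebraMap K L y →
        algebraMap K L (μ / n (κ x)) * (bracket u x * σ (bracket v x) * σ (σ (bracket w x))) =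
        algebraMap K L μ * ((A u + algebraMap K L y * B u) *
          (σ (A v) + algebraMap K L y * σ (B v)) *
          (σ (σ (A w)) + algebraMap K L y * σ (σ (B w)))) := by
      intro x μ hx y hy
      have h0 : algebraMap K L (n (κ x)) ≠ 0 := by simpa using hn0 (hκ0 hx)
      rw [hform u x hx, hform v x hx, hform w x hx, hy, map_div₀, div_mul_eq_mul_div,
        div_eq_iff h0, hn]
      simp only [map_mul, map_add, AlgEquiv.commutes]
      ring
    have keyb : algebraMap K L (-1 / n ρ) *
        (bracket u b * σ (bracket v b) * σ (σ (bracket w b))) =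
        -(B u * σ (B v) * σ (σ (B w))) := by
      have h0 : algebraMap K L (n ρ) ≠ 0 := by simpa using hb
      rw [hformb u, hformb v, hformb w, map_div₀, div_mul_eq_mul_div, div_eq_iff h0, hn]
      simp only [map_mul, map_neg, map_one]
      ring
    have hsum : ∀ (x : Option L) (k : K) (F : Option L → L),
        ∑ y, algebraMap K L ((Pi.single x k : Option L → K) y) * F y = algebraMap K L k * F x := by
      intro x k F
      rw [Finset.sum_eq_single x]
      · simp
      · intro y _ hy
        simp [hy]
      · simp
    simp only [Pi.add_apply, map_add, add_mul, Finset.sum_add_distrib, hsum]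
    rw [key a _ hab 0 (by rw [crossRatio_zero, map_zero]),
      key d _ hdb 1 (by rw [crossRatio_one had hdb, map_one]), key p _ hpb s hs, key r _ hrb t ht,
      keyb]
    have m0' := congrArg (algebraMap K L) m0
    have m1' := congrArg (algebraMap K L) m1
    have m2' := congrArg (algebraMap K L) m2
    have m3' := congrArg (algebraMap K L) m3
    simp only [map_add, map_mul, map_pow, map_zero, map_one] at m0' m1' m2' m3' ⊢
    linear_combination (A u * σ (A v) * σ (σ (A w))) * m0' +
      (A u * σ (A v) * σ (σ (B w)) + A u * σ (B v) * σ (σ (A w)) + B u * σ (A v) * σ (σ (A w))) *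
        m1' +
      (A u * σ (B v) * σ (σ (B w)) + B u * σ (B v) * σ (σ (A w)) + B u * σ (A v) * σ (σ (B w))) *
        m2' +
      (B u * σ (B v) * σ (σ (B w))) * m3'
  · simp [had, hab, hpa.symm, hra.symm, ha', μa, hs0, ht0]
  · intro x h1 h2 h3 h4 h5
    simp [h1, h2, h3, h4, h5]

end

/-! ### Counting words of weight five. -/

section

variable {K L : Type*} [Field K] [Field L] [Algebra K L] [Fintype L] {σ : L ≃ₐ[K] L}

/-- Double counting of words with an ordering of their support: each word has `5! = 120` orderings,
and ordered words biject with the configurations in `S`. -/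
theorem card_weight_five [Fintype K] [DecidableEq K] (hL : 4 ≤ Fintype.card L)
    (hfix : ∀ x : L, σ x = x → x ∈ Set.range (algebraMap K L))
    (hN : ∀ x : L, ∃ n : K, algebraMap K L n = x * σ x * σ (σ x)) :
    120 * {c | c ∈ tensorRelations K σ ∧ hammingNorm c = 5}.ncard =
      (Fintype.card L + 1).descFactorial 3 *
        ((Fintype.card K - 2) * (Fintype.card K - 2) - (Fintype.card K - 2)) *
        (Fintype.card K - 1) := by
  classical
  set W := {c : Option L → K // c ∈ tensorRelations K σ ∧ hammingNorm c = 5}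
  let T := Σ c : W, Fin 5 ≃ {p // c.1 p ≠ 0}
  have hT : Fintype.card T = 120 * {c | c ∈ tensorRelations K σ ∧ hammingNorm c = 5}.ncard := by
    have h1 : ∀ c : W, Fintype.card (Fin 5 ≃ {p // c.1 p ≠ 0}) = 120 := by
      intro c
      have hcard : Fintype.card {p // c.1 p ≠ 0} = 5 := by
        rw [Fintype.card_subtype]
        exact c.2.2
      rw [Fintype.card_equiv (Fintype.equivFinOfCardEq hcard).symm]
      rfl
    rw [Fintype.card_sigma, Finset.sum_congr rfl fun c _ => h1 c, Finset.sum_const, smul_eq_mul,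
      mul_comm, Finset.card_univ, ← Nat.card_eq_fintype_card]
    rfl
  let A : Finset K := Finset.univ \ {0, 1}
  have hA : A.card = Fintype.card K - 2 := by
    rw [Finset.card_sdiff_of_subset (Finset.subset_univ _), Finset.card_pair zero_ne_one,
      Finset.card_univ]
  let S : Finset ((Fin 3 ↪ Option L) × (L × L) × K) :=
    Finset.univ ×ˢ (A.offDiag.image (Prod.map (algebraMap K L) (algebraMap K L)) ×ˢ
      Finset.univ.erase 0)
  have hS : S.card = (Fintype.card L + 1).descFactorial 3 *
        ((Fintype.card K - 2) * (Fintype.card K - 2) - (Fintype.card K - 2)) *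
        (Fintype.card K - 1) := by
    simp only [S]
    rw [Finset.card_product, Finset.card_product, Finset.card_image_of_injective _
      (Prod.map_injective.2 ⟨(algebraMap K L).injective, (algebraMap K L).injective⟩),
      Finset.offDiag_card, hA, Finset.card_erase_of_mem (Finset.mem_univ _), Finset.card_univ,
      Finset.card_univ, Fintype.card_embedding_eq, Fintype.card_option, Fintype.card_fin, mul_assoc]
  rw [← hT, ← hS, ← Finset.card_univ]
  have hinj : ∀ (x : T) {i j : Fin 5}, i ≠ j → (x.2 i).1 ≠ (x.2 j).1 := fun x i j hij h =>
    hij (x.2.injective (Subtype.ext h))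
  have hsupp : ∀ (x : T) (p : Option L), (∀ i, p ≠ (x.2 i).1) → x.1.1 p = 0 := by
    intro x p h
    by_contra hp
    obtain ⟨i, hi⟩ := x.2.surjective ⟨p, hp⟩
    exact h i (by rw [hi])
  refine Finset.card_bij (fun x _ =>
    ((Fin.castLEEmb (by norm_num : 3 ≤ 5)).trans
      (x.2.toEmbedding.trans (Function.Embedding.subtype _)),
      (crossRatio (x.2 0).1 (x.2 1).1 (x.2 2).1 (x.2 3).1,
        crossRatio (x.2 0).1 (x.2 1).1 (x.2 2).1 (x.2 4).1), x.1.1 (x.2 0).1)) ?_ ?_ ?_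
  · intro x _
    simp only [S, Finset.mem_product, Finset.mem_univ, true_and, Finset.mem_erase,
      Finset.mem_image, Finset.mem_offDiag, A, Finset.mem_sdiff, Finset.mem_insert,
      Finset.mem_singleton, not_or]
    refine ⟨?_, (x.2 0).2, trivial⟩
    obtain ⟨s, hs⟩ := crossRatio_mem_range hfix x.1.2.1 (hinj x (show (0 : Fin 5) ≠ 1 by decide))
      (hinj x (show (2 : Fin 5) ≠ 1 by decide)) (hinj x (show (4 : Fin 5) ≠ 1 by decide))
      (hinj x (show (0 : Fin 5) ≠ 3 by decide)) (hinj x (show (2 : Fin 5) ≠ 3 by decide))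
      (hinj x (show (4 : Fin 5) ≠ 3 by decide)) (hinj x (show (3 : Fin 5) ≠ 1 by decide))
      (fun p h0 h2 h1 h3 h4 => hsupp x p fun i => by fin_cases i <;> assumption)
      (x.2 3).2 (x.2 1).2
    obtain ⟨t, ht⟩ := crossRatio_mem_range hfix x.1.2.1 (hinj x (show (0 : Fin 5) ≠ 1 by decide))
      (hinj x (show (2 : Fin 5) ≠ 1 by decide)) (hinj x (show (3 : Fin 5) ≠ 1 by decide))
      (hinj x (show (0 : Fin 5) ≠ 4 by decide)) (hinj x (show (2 : Fin 5) ≠ 4 by decide))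
      (hinj x (show (3 : Fin 5) ≠ 4 by decide)) (hinj x (show (4 : Fin 5) ≠ 1 by decide))
      (fun p h0 h2 h1 h4 h3 => hsupp x p fun i => by fin_cases i <;> assumption)
      (x.2 4).2 (x.2 1).2
    have had := hinj x (show (0 : Fin 5) ≠ 1 by decide)
    have hdb := hinj x (show (1 : Fin 5) ≠ 2 by decide)
    have hab := hinj x (show (0 : Fin 5) ≠ 2 by decide)
    have hne : ∀ {i j : Fin 5}, i ≠ 2 → j ≠ 2 → i ≠ j →
        crossRatio (x.2 0).1 (x.2 1).1 (x.2 2).1 (x.2 i).1 ≠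
          crossRatio (x.2 0).1 (x.2 1).1 (x.2 2).1 (x.2 j).1 := fun hi hj hij h =>
      hinj x hij (crossRatio_injOn had hdb hab (hinj x hi) (hinj x hj) h)
    have h30 := hne (show (3 : Fin 5) ≠ 2 by decide) (show (0 : Fin 5) ≠ 2 by decide) (by decide)
    have h31 := hne (show (3 : Fin 5) ≠ 2 by decide) (show (1 : Fin 5) ≠ 2 by decide) (by decide)
    have h40 := hne (show (4 : Fin 5) ≠ 2 by decide) (show (0 : Fin 5) ≠ 2 by decide) (by decide)
    have h41 := hne (show (4 : Fin 5) ≠ 2 by decide) (show (1 : Fin 5) ≠ 2 by decide) (by decide)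
    have h34 := hne (show (3 : Fin 5) ≠ 2 by decide) (show (4 : Fin 5) ≠ 2 by decide) (by decide)
    rw [← hs, ← ht] at h34
    rw [crossRatio_zero, ← hs] at h30
    rw [crossRatio_zero, ← ht] at h40
    rw [crossRatio_one had hdb, ← hs] at h31
    rw [crossRatio_one had hdb, ← ht] at h41
    exact ⟨(s, t), ⟨⟨fun h => h30 (by simpa using h), fun h => h31 (by simpa using h)⟩,
      ⟨fun h => h40 (by simpa using h), fun h => h41 (by simpa using h)⟩,
      fun h => h34 (congrArg _ h)⟩, Prod.ext hs ht⟩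
  · intro x _ y _ h
    simp only [Prod.mk.injEq] at h
    obtain ⟨h1, ⟨h2, h3⟩, h4⟩ := h
    have e0 : (x.2 0).1 = (y.2 0).1 := DFunLike.congr_fun h1 0
    have e1 : (x.2 1).1 = (y.2 1).1 := DFunLike.congr_fun h1 1
    have e2 : (x.2 2).1 = (y.2 2).1 := DFunLike.congr_fun h1 2
    have had := hinj y (show (0 : Fin 5) ≠ 1 by decide)
    have hdb := hinj y (show (1 : Fin 5) ≠ 2 by decide)
    have hab := hinj y (show (0 : Fin 5) ≠ 2 by decide)
    rw [e0, e1, e2] at h2 h3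
    have e3 : (x.2 3).1 = (y.2 3).1 := crossRatio_injOn had hdb hab
      (e2 ▸ hinj x (show (3 : Fin 5) ≠ 2 by decide)) (hinj y (show (3 : Fin 5) ≠ 2 by decide)) h2
    have e4 : (x.2 4).1 = (y.2 4).1 := crossRatio_injOn had hdb hab
      (e2 ▸ hinj x (show (4 : Fin 5) ≠ 2 by decide)) (hinj y (show (4 : Fin 5) ≠ 2 by decide)) h3
    have hall : ∀ i, (x.2 i).1 = (y.2 i).1 := fun i => by fin_cases i <;> assumption
    -- The two words agree at the first point, so their difference lives on the other four and
    -- vanishes by the weight bound.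
    have hc : x.1.1 - y.1.1 = 0 := by
      apply tensorRelation_eq_zero hL (Submodule.sub_mem _ x.1.2.1 y.1.2.1)
        {(x.2 1).1, (x.2 2).1, (x.2 3).1, (x.2 4).1} Finset.card_le_four
      intro p hp
      simp only [Finset.mem_insert, Finset.mem_singleton, not_or] at hp
      obtain ⟨n1, n2, n3, n4⟩ := hp
      by_cases h0 : p = (x.2 0).1
      · rw [h0, Pi.sub_apply, h4, e0, sub_self]
      · have hx : ∀ i, p ≠ (x.2 i).1 := fun i => by fin_cases i <;> assumption
        rw [Pi.sub_apply, hsupp x p hx, hsupp y p fun i => hall i ▸ hx i, sub_zero]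
    have hc' : x.1 = y.1 := Subtype.ext (sub_eq_zero.1 hc)
    obtain ⟨c, f⟩ := x
    obtain ⟨c', f'⟩ := y
    obtain rfl : c = c' := hc'
    congr 1
    exact Equiv.ext fun i => Subtype.ext (hall i)
  · rintro ⟨g, ⟨s', t'⟩, k⟩ hmem
    simp only [S, Finset.mem_product, Finset.mem_univ, true_and, Finset.mem_erase,
      Finset.mem_image, Finset.mem_offDiag, A, Finset.mem_sdiff, Finset.mem_insert,
      Finset.mem_singleton, not_or, and_true, Prod.exists, Prod.map_apply, Prod.mk.injEq] at hmem
    obtain ⟨⟨s, t, ⟨⟨hs0, hs1⟩, ⟨ht0, ht1⟩, hst⟩, rfl, rfl⟩, hk⟩ := hmem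
    have had : g 0 ≠ g 1 := g.injective.ne (by decide)
    have hab : g 0 ≠ g 2 := g.injective.ne (by decide)
    have hdb : g 1 ≠ g 2 := g.injective.ne (by decide)
    obtain ⟨p, hpb, hp⟩ := exists_crossRatio_eq had hdb hab (algebraMap K L s)
    obtain ⟨r, hrb, hr⟩ := exists_crossRatio_eq had hdb hab (algebraMap K L t)
    have hpa : p ≠ g 0 := by
      rintro rfl
      rw [crossRatio_zero] at hp
      exact hs0 (by simpa using hp.symm)
    have hra : r ≠ g 0 := by
      rintro rfl
      rw [crossRatio_zero] at hr
      exact ht0 (by simpa using hr.symm)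
    obtain ⟨c₀, hc₀, hc₀a, hsup⟩ := exists_tensorRelation hN had hab hdb hpa hpb hra hrb hs0 hs1
      ht0 ht1 hst hp hr
    -- Rescale to the prescribed value `k` at the first point.
    set c := (k / c₀ (g 0)) • c₀ with hc
    have hcm : c ∈ tensorRelations K σ := Submodule.smul_mem _ _ hc₀
    have hca : c (g 0) = k := by simp [hc, hc₀a]
    have hcsup : ∀ x, x ≠ g 0 → x ≠ g 1 → x ≠ g 2 → x ≠ p → x ≠ r → c x = 0 := by
      intro x h0 h1 h2 h3 h4
      simp [hc, hsup x h0 h1 h2 h3 h4]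
    have hc0 : c ≠ 0 := fun h => hk (by rw [← hca, h, Pi.zero_apply])
    have hge := five_le_card_support hL hcm hc0
    have hsub : (Finset.univ.filter fun x => c x ≠ 0) ⊆ {g 0, g 1, g 2, p, r} := by
      intro x hx
      by_contra h
      simp only [Finset.mem_insert, Finset.mem_singleton, not_or] at h
      exact (Finset.mem_filter.1 hx).2 (hcsup x h.1 h.2.1 h.2.2.1 h.2.2.2.1 h.2.2.2.2)
    have heq := Finset.eq_of_subset_of_card_le hsub (Finset.card_le_five.trans hge)
    have hw : hammingNorm c = 5 :=
      le_antisymm ((Finset.card_le_card hsub).trans Finset.card_le_five) hge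
    have hmem : ∀ x, x ∈ ({g 0, g 1, g 2, p, r} : Finset (Option L)) → c x ≠ 0 := by
      intro x hx
      rw [← heq] at hx
      exact (Finset.mem_filter.1 hx).2
    let f : Fin 5 → {x // c x ≠ 0} := fun i => ⟨![g 0, g 1, g 2, p, r] i, hmem _ (by
      fin_cases i <;> simp)⟩
    have hf : Function.Bijective f := by
      rw [Fintype.bijective_iff_surjective_and_card]
      constructor
      · rintro ⟨x, hx⟩
        have := hsub (Finset.mem_filter.2 ⟨Finset.mem_univ _, hx⟩)
        simp only [Finset.mem_insert, Finset.mem_singleton] at this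
        rcases this with rfl | rfl | rfl | rfl | rfl
        exacts [⟨0, rfl⟩, ⟨1, rfl⟩, ⟨2, rfl⟩, ⟨3, rfl⟩, ⟨4, rfl⟩]
      · rw [Fintype.card_fin, Fintype.card_subtype]
        exact hw.symm
    refine ⟨⟨⟨c, hcm, hw⟩, Equiv.ofBijective f hf⟩, Finset.mem_univ _, ?_⟩
    refine Prod.ext ?_ (Prod.ext (Prod.ext hp hr) hca)
    ext1 i
    fin_cases i <;> rfl

end

/-! ### The relations in affine coordinates. -/

section

variable {K L : Type*} [Field K] [Field L] [Algebra K L] [Fintype L] {σ : L ≃ₐ[K] L}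

/-- The tensor has eight coordinates, falling into four orbits under `σ`. As `c` has values in `K`,
applying `σ` to one equation gives the rest of its orbit. -/
theorem mem_tensorRelations_iff (hσ : ∀ x, σ (σ (σ x)) = x) {c : Option L → K} :
    c ∈ tensorRelations K σ ↔
      ∑ x, algebraMap K L (c (some x)) = 0 ∧ ∑ x, algebraMap K L (c (some x)) * x = 0 ∧
      ∑ x, algebraMap K L (c (some x)) * (σ x * σ (σ x)) = 0 ∧
      ∑ x, algebraMap K L (c (some x)) * (x * σ x * σ (σ x)) + algebraMap K L (c none) = 0 := by
  rw [mem_tensorRelations]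
  constructor
  · intro h
    have h0 := h (0, -1) (0, -1) (0, -1)
    have h1 := h (1, 0) (0, -1) (0, -1)
    have h2 := h (0, -1) (1, 0) (1, 0)
    have h3 := h (1, 0) (1, 0) (1, 0)
    simp [bracket, homog, Fintype.sum_option] at h0 h1 h2 h3
    exact ⟨h0, h1, h2, by rw [add_comm]; exact h3⟩
  · rintro ⟨h0, h1, h2, h3⟩ u v w
    have h1' : ∑ x, algebraMap K L (c (some x)) * σ x = 0 := by
      simpa using congrArg σ h1
    have h1'' : ∑ x, algebraMap K L (c (some x)) * σ (σ x) = 0 := by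
      simpa using congrArg σ h1'
    have h2' : ∑ x, algebraMap K L (c (some x)) * (σ (σ x) * x) = 0 := by
      simpa [hσ] using congrArg σ h2
    have h2'' : ∑ x, algebraMap K L (c (some x)) * (x * σ x) = 0 := by
      simpa [hσ] using congrArg σ h2'
    have key : ∑ x, algebraMap K L (c (some x)) * (bracket u (some x) * σ (bracket v (some x)) *
        σ (σ (bracket w (some x)))) =
        u.1 * σ v.1 * σ (σ w.1) * ∑ x, algebraMap K L (c (some x)) * (x * σ x * σ (σ x)) -
        u.1 * σ v.1 * σ (σ w.2) * ∑ x, algebraMap K L (c (some x)) * (x * σ x) -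
        u.1 * σ v.2 * σ (σ w.1) * ∑ x, algebraMap K L (c (some x)) * (σ (σ x) * x) -
        u.2 * σ v.1 * σ (σ w.1) * ∑ x, algebraMap K L (c (some x)) * (σ x * σ (σ x)) +
        u.1 * σ v.2 * σ (σ w.2) * ∑ x, algebraMap K L (c (some x)) * x +
        u.2 * σ v.1 * σ (σ w.2) * ∑ x, algebraMap K L (c (some x)) * σ x +
        u.2 * σ v.2 * σ (σ w.1) * ∑ x, algebraMap K L (c (some x)) * σ (σ x) -
        u.2 * σ v.2 * σ (σ w.2) * ∑ x, algebraMap K L (c (some x)) := by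
      simp only [Finset.mul_sum, ← Finset.sum_add_distrib, ← Finset.sum_sub_distrib]
      refine Finset.sum_congr rfl fun x _ => ?_
      simp only [bracket, homog, map_sub, map_mul, map_one]
      ring
    rw [Fintype.sum_option, key, h0, h1, h1', h1'', h2, h2', h2'']
    simp only [bracket, homog, map_sub, map_mul, map_one, map_zero]
    linear_combination (u.1 * σ v.1 * σ (σ w.1)) * h3

end

/-! ### Frobenius, trace and norm of the cubic extension. -/

section

variable {K L : Type*} [Field K] [Fintype K] [Field L] [Algebra K L] [Fintype L]

/-- The Frobenius automorphism `x ↦ x ^ |K|` of `L` over `K`. -/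
noncomputable abbrev frob (K L : Type*) [Field K] [Fintype K] [Field L] [Algebra K L] [Fintype L] :
    L ≃ₐ[K] L :=
  haveI := Module.Finite.of_finite (R := K) (M := L)
  FiniteField.frobeniusAlgEquivOfAlgebraic K L

theorem frob_apply (x : L) : frob K L x = x ^ Fintype.card K := rfl

theorem mem_range_of_frob_eq {x : L} (h : frob K L x = x) : x ∈ Set.range (algebraMap K L) := by
  have := Module.Finite.of_finite (R := K) (M := L)
  have h' : x ∈ (⊥ : IntermediateField K L) := by
    rw [IsGalois.mem_bot_iff_fixed]
    intro f
    obtain ⟨n, rfl⟩ := (FiniteField.bijective_frobeniusAlgEquivOfAlgebraic_pow K L).2 f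
    rw [AlgEquiv.coe_pow]
    exact Function.iterate_fixed h _
  exact IntermediateField.mem_bot.1 h'

theorem frob_cube (hL : Module.finrank K L = 3) (x : L) : frob K L (frob K L (frob K L x)) = x := by
  have := Module.Finite.of_finite (R := K) (M := L)
  have h := pow_orderOf_eq_one (FiniteField.frobeniusAlgEquivOfAlgebraic K L)
  rw [FiniteField.orderOf_frobeniusAlgEquivOfAlgebraic, hL] at h
  exact DFunLike.congr_fun h x

theorem algebraMap_norm_eq_frob (hL : Module.finrank K L = 3) (x : L) :
    algebraMap K L (Algebra.norm K x) = x * frob K L x * frob K L (frob K L x) := by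
  rw [FiniteField.algebraMap_norm_eq_prod_pow, hL, Finset.prod_range_succ, Finset.prod_range_succ,
    Finset.prod_range_one, Nat.card_eq_fintype_card]
  simp only [frob_apply]
  ring

theorem frob_mul_frob_frob (x : L) :
    frob K L x * frob K L (frob K L x) = x ^ (Fintype.card K + Fintype.card K ^ 2) := by
  simp only [frob_apply]
  ring

theorem trace_frob (x : L) : Algebra.trace K L (frob K L x) = Algebra.trace K L x :=
  Algebra.trace_eq_of_algEquiv _ _

theorem card_eq_cube (hL : Module.finrank K L = 3) : Fintype.card L = Fintype.card K ^ 3 := by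
  rw [Module.card_eq_pow_finrank (K := K), hL]

/-- The degree of `θ` divides 3, and it is not 1 since a nonzero element of `K` has order at most `q
- 1`. -/
theorem linearIndependent_primitive (hL : Module.finrank K L = 3) {θ : L}
    (hθ : IsPrimitiveRoot θ (Fintype.card K ^ 3 - 1)) :
    LinearIndependent K fun i : Fin 3 => θ ^ (i : ℕ) := by
  have := Module.Finite.of_finite (R := K) (M := L)
  have hint : IsIntegral K θ := Algebra.IsIntegral.isIntegral θ
  have hdvd : (minpoly K θ).natDegree ∣ 3 := hL ▸ minpoly.degree_dvd hint
  have hq : 2 ≤ Fintype.card K := Fintype.one_lt_card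
  have hne : (minpoly K θ).natDegree ≠ 1 := by
    rw [Ne, minpoly.natDegree_eq_one_iff]
    rintro ⟨a, rfl⟩
    have hq3 : Fintype.card K < Fintype.card K ^ 3 := by
      nlinarith [Nat.mul_le_mul hq hq, pow_succ (Fintype.card K) 2, sq (Fintype.card K)]
    have ha : a ≠ 0 := by
      rintro rfl
      rw [map_zero] at hθ
      exact hθ.ne_zero (by omega) rfl
    have h1 : algebraMap K L a ^ (Fintype.card K - 1) = 1 := by
      rw [← map_pow, FiniteField.pow_card_sub_one_eq_one a ha, map_one]
    have := Nat.le_of_dvd (by omega) (hθ.dvd_of_pow_eq_one _ h1)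
    omega
  have h3 : (minpoly K θ).natDegree = 3 := ((Nat.dvd_prime Nat.prime_three).1 hdvd).resolve_left hne
  have := linearIndependent_pow (K := K) θ
  rwa [h3] at this

theorem eq_zero_of_trace_mul (hL : Module.finrank K L = 3) {θ : L}
    (hθ : IsPrimitiveRoot θ (Fintype.card K ^ 3 - 1)) {s : L}
    (h0 : Algebra.trace K L s = 0) (h1 : Algebra.trace K L (θ * s) = 0)
    (h2 : Algebra.trace K L (θ ^ 2 * s) = 0) : s = 0 := by
  have := Module.Finite.of_finite (R := K) (M := L)
  have hspan := (linearIndependent_primitive hL hθ).span_eq_top_of_card_eq_finrank' (by simp [hL])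
  have hzero : Algebra.traceForm K L s = 0 := by
    rw [← LinearMap.ker_eq_top, eq_top_iff, ← hspan, Submodule.span_le]
    rintro _ ⟨i, rfl⟩
    rw [SetLike.mem_coe, LinearMap.mem_ker, Algebra.traceForm_apply, mul_comm]
    fin_cases i
    · simpa using h0
    · simpa using h1
    · simpa using h2
  apply (traceForm_nondegenerate K L).1 s
  intro y
  rw [hzero]
  rfl

theorem eq_zero_of_forall_trace_mul {α : L} (h : ∀ x, Algebra.trace K L (α * x) = 0) : α = 0 := by
  have := Module.Finite.of_finite (R := K) (M := L)
  exact (traceForm_nondegenerate K L).1 α h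

theorem exists_frob_ne (hL : Module.finrank K L = 3) : ∃ x : L, frob K L x ≠ x := by
  by_contra! h
  have hs : Function.Surjective (algebraMap K L) := fun x => mem_range_of_frob_eq (h x)
  have := Fintype.card_le_of_surjective _ hs
  rw [card_eq_cube hL] at this
  have hq : 2 ≤ Fintype.card K := Fintype.one_lt_card
  nlinarith [Nat.mul_le_mul hq hq, pow_succ (Fintype.card K) 2, sq (Fintype.card K)]

theorem eq_zero_of_forall_trace_add (hL : Module.finrank K L = 3) {a : K} {α β : L}
    (h : ∀ x, a + Algebra.trace K L (α * x) +
      Algebra.trace K L (β * (frob K L x * frob K L (frob K L x))) = 0) :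
    a = 0 ∧ α = 0 ∧ β = 0 := by
  have ha : a = 0 := by simpa using h 0
  subst ha
  have hβ : β = 0 := by
    -- Polarising the quadratic form removes the linear term. Nondegeneracy of the trace then gives
    -- `β σ(y) + σ(β) y = 0` for all `y`.
    have h1 : ∀ x y, Algebra.trace K L (β * (frob K L x * frob K L (frob K L y))) +
        Algebra.trace K L (β * (frob K L y * frob K L (frob K L x))) = 0 := by
      intro x y
      have e1 := h (x + y)
      have e2 := h x
      have e3 := h y
      have : β * (frob K L (x + y) * frob K L (frob K L (x + y))) =
        β * (frob K L x * frob K L (frob K L x)) + β * (frob K L y * frob K L (frob K L y)) +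
        (β * (frob K L x * frob K L (frob K L y)) +
          β * (frob K L y * frob K L (frob K L x))) := by
        simp only [map_add]; ring
      rw [this, mul_add] at e1
      simp only [map_add (Algebra.trace K L)] at e1
      linear_combination e1 - e2 - e3
    have h2 : ∀ y, β * frob K L y + frob K L β * y = 0 := by
      intro y
      have h3 : frob K L β * frob K L (frob K L y) +
          frob K L (frob K L β) * frob K L y = 0 := by
        apply eq_zero_of_forall_trace_mul (K := K)
        intro x
        rw [add_mul, map_add (Algebra.trace K L), ← h1 y x]
        congr 1
        · rw [← trace_frob (β * _)]
          simp only [map_mul, frob_cube hL]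
          ring_nf
        · rw [← trace_frob (β * _), ← trace_frob (frob K L (β * _))]
          simp only [map_mul, frob_cube hL]
          ring_nf
      apply (frob K L).injective
      rw [map_zero, ← h3]
      simp only [map_add, map_mul]
    -- Taking `y = 1` gives `σ(β) = -β`, so `β` is killed by `σ(x) - x` for any `x` moved by `σ`.
    obtain ⟨x, hx⟩ := exists_frob_ne (K := K) (L := L) hL
    have e1 := h2 1
    have e2 := h2 x
    rw [map_one] at e1
    have : β * (frob K L x - x) = 0 := by linear_combination e2 - x * e1
    exact (mul_eq_zero.1 this).resolve_right (sub_ne_zero.2 hx)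
  subst hβ
  exact ⟨rfl, eq_zero_of_forall_trace_mul fun x => by simpa using h x, rfl⟩

end

/-! ### Duals of row spaces, and the dual of the ovoid code. -/

theorem mem_dualCode_span_row {K : Type*} [Field K] {n : ℕ} {ι : Type*} {G : Matrix ι (Fin n) K}
    {c : Fin n → K} :
    c ∈ dualCode (Submodule.span K (Set.range G.row)) ↔ ∀ i, ∑ j, G i j * c j = 0 := by
  rw [dualCode, Submodule.mem_orthogonalBilin_iff]
  constructor
  · intro h i
    exact h _ (Submodule.subset_span ⟨i, rfl⟩)
  · intro h y hy
    induction hy using Submodule.span_induction with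
    | mem y hy =>
      obtain ⟨i, rfl⟩ := hy
      exact h i
    | zero => simp
    | add y z _ _ hy hz => rw [map_add, LinearMap.add_apply, hy, hz, add_zero]
    | smul a y _ hy => rw [map_smul, LinearMap.smul_apply, hy, smul_zero]

theorem finrank_dualCode_span_row {K : Type*} [Field K] {n : ℕ} {ι : Type*} [Fintype ι]
    {G : Matrix ι (Fin n) K} (hG : LinearIndependent K G.row) :
    Module.finrank K (dualCode (Submodule.span K (Set.range G.row))) = n - Fintype.card ι := by
  have h : dualCode (Submodule.span K (Set.range G.row)) = LinearMap.ker G.mulVecLin := by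
    ext c
    rw [mem_dualCode_span_row, LinearMap.mem_ker, funext_iff]
    rfl
  have h1 := G.mulVecLin.finrank_range_add_finrank_ker
  rw [Module.finrank_fin_fun, ← Matrix.rank, hG.rank_matrix] at h1
  rw [h]
  omega

section

variable {K L : Type*} [Field K] [Fintype K] [Field L] [Algebra K L] [Fintype L]

theorem sum_ovoidMatrix (θ : L) {m : ℕ} (x : Fin m ≃ L) (c : Option L → K) (i : Fin 8) :
    ∑ j, ovoidMatrix K θ x i j * c (finSuccEquivLast.trans (Equiv.optionCongr x) j) =
      ∑ y, ovoidColumn K θ y i * c (some y) + (Pi.single 7 1 : Fin 8 → K) i * c none := by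
  rw [Fin.sum_univ_castSucc, ← Equiv.sum_comp x]
  simp [ovoidMatrix]

/-- Since `1`, `θ`, `θ²` is a basis and the trace form is nondegenerate, each triple of trace rows
amounts to one equation over `L`. -/
theorem comp_mem_dualCode_iff (hL : Module.finrank K L = 3) {θ : L}
    (hθ : IsPrimitiveRoot θ (Fintype.card K ^ 3 - 1)) {m : ℕ} (x : Fin m ≃ L) (c : Option L → K) :
    (fun j => c (finSuccEquivLast.trans (Equiv.optionCongr x) j)) ∈ dualCode (ovoidCode K θ x) ↔
      c ∈ tensorRelations K (frob K L) := by
  rw [ovoidCode, mem_dualCode_span_row, mem_tensorRelations_iff (frob_cube hL)]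
  simp_rw [sum_ovoidMatrix, frob_mul_frob_frob, ← algebraMap_norm_eq_frob hL]
  have htr : ∀ (z : L) (F : L → L), ∑ y, Algebra.trace K L (z * F y) * c (some y) =
      Algebra.trace K L (z * ∑ y, algebraMap K L (c (some y)) * F y) := by
    intro z F
    rw [Finset.mul_sum, map_sum]
    refine Finset.sum_congr rfl fun y _ => ?_
    rw [← Algebra.smul_def, mul_smul_comm, map_smul, smul_eq_mul, mul_comm]
  have htr1 : ∀ (F : L → L), ∑ y, Algebra.trace K L (F y) * c (some y) =
      Algebra.trace K L (∑ y, algebraMap K L (c (some y)) * F y) := by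
    intro F
    simpa using htr 1 F
  have hinj := FaithfulSMul.algebraMap_injective K L
  have e0 : ∑ y, algebraMap K L (c (some y)) = 0 ↔ ∑ y, c (some y) = 0 := by
    rw [← map_sum, map_eq_zero_iff _ hinj]
  have e3 : ∑ y, algebraMap K L (c (some y)) * algebraMap K L (Algebra.norm K y) +
      algebraMap K L (c none) = 0 ↔ ∑ y, Algebra.norm K y * c (some y) + c none = 0 := by
    rw [← map_eq_zero_iff _ hinj]
    simp [mul_comm]
  rw [e0, e3]
  have hcol : ∀ y, ovoidColumn K θ y = ![1, Algebra.trace K L y, Algebra.trace K L (θ * y),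
    Algebra.trace K L (θ ^ 2 * y), Algebra.trace K L (y ^ (Fintype.card K + Fintype.card K ^ 2)),
    Algebra.trace K L (θ * y ^ (Fintype.card K + Fintype.card K ^ 2)),
    Algebra.trace K L (θ ^ 2 * y ^ (Fintype.card K + Fintype.card K ^ 2)),
    Algebra.norm K y] := fun y => rfl
  have t1 := htr1 fun y => y
  have t2 := htr θ fun y => y
  have t3 := htr (θ ^ 2) fun y => y
  have t4 := htr1 fun y => y ^ (Fintype.card K + Fintype.card K ^ 2)
  have t5 := htr θ fun y => y ^ (Fintype.card K + Fintype.card K ^ 2)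
  have t6 := htr (θ ^ 2) fun y => y ^ (Fintype.card K + Fintype.card K ^ 2)
  constructor
  · intro h
    have h0 := h 0
    have h1 := h 1
    have h2 := h 2
    have h3 := h 3
    have h4 := h 4
    have h5 := h 5
    have h6 := h 6
    have h7 := h 7
    simp [hcol, t1, t2, t3, t4, t5, t6, -map_sum] at h0 h1 h2 h3 h4 h5 h6 h7
    exact ⟨h0, eq_zero_of_trace_mul hL hθ h1 h2 h3, eq_zero_of_trace_mul hL hθ h4 h5 h6, h7⟩
  · rintro ⟨h0, h1, h2, h3⟩ i
    fin_cases i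
    all_goals simp [hcol, t1, t2, t3, t4, t5, t6, h0, h1, h2, h3]

theorem linearIndependent_ovoidMatrix_row (hL : Module.finrank K L = 3) {θ : L}
    (hθ : IsPrimitiveRoot θ (Fintype.card K ^ 3 - 1)) {m : ℕ} (x : Fin m ≃ L) :
    LinearIndependent K (ovoidMatrix K θ x).row := by
  rw [Fintype.linearIndependent_iff]
  intro g hg
  have h7 : g 7 = 0 := by
    have := congrFun hg (Fin.last m)
    simpa [ovoidMatrix, Finset.sum_apply, Pi.single_apply] using this
  have h : ∀ y : L, g 0 +
      Algebra.trace K L ((algebraMap K L (g 1) + algebraMap K L (g 2) * θ +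
        algebraMap K L (g 3) * θ ^ 2) * y) +
      Algebra.trace K L ((algebraMap K L (g 4) + algebraMap K L (g 5) * θ +
        algebraMap K L (g 6) * θ ^ 2) * (frob K L y * frob K L (frob K L y))) = 0 := by
    intro y
    have := congrFun hg (x.symm y).castSucc
    simp only [Finset.sum_apply, Fin.sum_univ_eight, h7] at this
    simp [ovoidMatrix, ovoidColumn] at this
    rw [frob_mul_frob_frob]
    simp only [add_mul, smul_mul_assoc, ← Algebra.smul_def, map_add, map_smul, smul_eq_mul]
    linear_combination this
  have hli := Fintype.linearIndependent_iff.1 (linearIndependent_primitive hL hθ)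
  have hli' : ∀ a b d : K, algebraMap K L a + algebraMap K L b * θ + algebraMap K L d * θ ^ 2 = 0 →
      a = 0 ∧ b = 0 ∧ d = 0 := by
    intro a b d h
    have := hli ![a, b, d] (by simpa [Fin.sum_univ_three, Algebra.smul_def] using h)
    exact ⟨this 0, this 1, this 2⟩
  obtain ⟨h0, hα, hβ⟩ := eq_zero_of_forall_trace_add hL h
  obtain ⟨h1, h2, h3⟩ := hli' _ _ _ hα
  obtain ⟨h4, h5, h6⟩ := hli' _ _ _ hβ
  intro i
  fin_cases i <;> assumption

end

/-! ### Explicit words for small `q`, and the rational form of the count. -/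

section

variable {K L : Type*} [Field K] [Fintype K] [Field L] [Algebra K L] [Fintype L]

/-- Over the field of 8 elements the power sums with exponents 0, 1 and 6 vanish, while exponent 7
gives -1, cancelled by the point at infinity. -/
theorem one_mem_tensorRelations (hL : Module.finrank K L = 3) (hq : Fintype.card K = 2) :
    (1 : Option L → K) ∈ tensorRelations K (frob K L) := by
  classical
  have hcard : Fintype.card L = 8 := by rw [card_eq_cube hL, hq]; rfl
  have h8 : (8 : L) = 0 := by
    have := FiniteField.cast_card_eq_zero L
    rw [hcard] at this
    exact_mod_cast this
  have hpow : ∀ i, i < 7 → ∑ x : L, x ^ i = 0 := fun i hi =>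
    FiniteField.sum_pow_lt_card_sub_one L i (by rw [hcard]; exact hi)
  rw [mem_tensorRelations_iff (frob_cube hL)]
  simp only [Pi.one_apply, map_one, one_mul, frob_apply, hq]
  refine ⟨by simp [hcard, h8], by simpa using hpow 1 (by norm_num), ?_, ?_⟩
  · rw [← hpow 6 (by norm_num)]
    exact Finset.sum_congr rfl fun x _ => by ring
  · have h7 : ∀ x : L, x * x ^ 2 * (x ^ 2) ^ 2 = 1 - if x = 0 then 1 else 0 := by
      intro x
      split_ifs with hx
      · simp [hx]
      · have := FiniteField.pow_card_sub_one_eq_one x hx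
        rw [hcard] at this
        rw [sub_zero, ← this]
        ring
    rw [Finset.sum_congr rfl fun x _ => h7 x]
    simp [hcard, h8]

theorem exists_trace_eq_zero_notMem_range (hL : Module.finrank K L = 3) :
    ∃ t : L, t + frob K L t + frob K L (frob K L t) = 0 ∧ t ∉ Set.range (algebraMap K L) := by
  have := Module.Finite.of_finite (R := K) (M := L)
  have h : ¬ LinearMap.ker (Algebra.trace K L) ≤ Submodule.span K {(1 : L)} := by
    intro hle
    have h1 := Submodule.finrank_mono hle
    rw [finrank_span_singleton one_ne_zero] at h1
    have h2 := (Algebra.trace K L).finrank_range_add_finrank_ker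
    have h3 := Submodule.finrank_le (LinearMap.range (Algebra.trace K L))
    rw [Module.finrank_self] at h3
    omega
  obtain ⟨t, ht, hts⟩ := SetLike.not_le_iff_exists.1 h
  refine ⟨t, ?_, ?_⟩
  · have := FiniteField.algebraMap_trace_eq_sum_pow K L t
    rw [LinearMap.mem_ker.1 ht, hL, Finset.sum_range_succ, Finset.sum_range_succ,
      Finset.sum_range_one, Nat.card_eq_fintype_card, map_zero] at this
    rw [this]
    simp only [frob_apply]
    ring
  · rintro ⟨a, rfl⟩
    exact hts (Submodule.mem_span_singleton.2 ⟨a, by rw [Algebra.smul_def, mul_one]⟩)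

/-- The word is the indicator of `K` minus that of a coset `t + K`, with `t` of trace zero outside
`K`. It serves to attain weight 6 when `q = 3`. -/
theorem exists_tensorRelation_weight_le [DecidableEq K] (hL : Module.finrank K L = 3)
    (hq : 3 ≤ Fintype.card K) :
    ∃ c ∈ tensorRelations K (frob K L), c ≠ 0 ∧ hammingNorm c ≤ Fintype.card K + Fintype.card K := by
  classical
  obtain ⟨t, ht, htr⟩ := exists_trace_eq_zero_notMem_range (K := K) hL
  have hne : ∀ i j : K, algebraMap K L i ≠ t + algebraMap K L j := fun i j h =>
    htr ⟨i - j, by rw [map_sub, h, add_sub_cancel_right]⟩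
  set c : Option L → K := ∑ i : K, (Pi.single (some (algebraMap K L i)) 1 -
    Pi.single (some (t + algebraMap K L i)) 1) with hc
  have hsum : ∀ F : L → L, ∑ y, algebraMap K L (c (some y)) * F y =
      ∑ i : K, F (algebraMap K L i) - ∑ i : K, F (t + algebraMap K L i) := by
    intro F
    simp only [hc, Finset.sum_apply, map_sum, Finset.sum_mul]
    rw [Finset.sum_comm, ← Finset.sum_sub_distrib]
    refine Finset.sum_congr rfl fun i _ => ?_
    simp [sub_mul, Finset.sum_sub_distrib, Pi.single_apply]
  have s0 : (Fintype.card K : L) = 0 := by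
    rw [← map_natCast (algebraMap K L), FiniteField.cast_card_eq_zero, map_zero]
  have s1 : ∑ i : K, algebraMap K L i = 0 := by
    rw [← map_sum]
    have := FiniteField.sum_pow_lt_card_sub_one K 1 (by omega)
    simp only [pow_one] at this
    rw [this, map_zero]
  refine ⟨c, ?_, ?_, ?_⟩
  · rw [mem_tensorRelations_iff (frob_cube hL)]
    refine ⟨?_, ?_, ?_, ?_⟩
    · simpa using hsum fun _ => 1
    · rw [hsum]
      simp [Finset.sum_add_distrib, s0]
    · rw [hsum fun y => frob K L y * frob K L (frob K L y), ← Finset.sum_sub_distrib]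
      have : ∀ i : K, frob K L (algebraMap K L i) * frob K L (frob K L (algebraMap K L i)) -
          frob K L (t + algebraMap K L i) * frob K L (frob K L (t + algebraMap K L i)) =
          -(frob K L t * frob K L (frob K L t)) -
            (frob K L t + frob K L (frob K L t)) * algebraMap K L i := by
        intro i
        simp only [map_add, AlgEquiv.commutes]
        ring
      rw [Finset.sum_congr rfl fun i _ => this i, Finset.sum_sub_distrib, ← Finset.mul_sum, s1]
      simp [s0]
    · have hnone : c none = 0 := by simp [hc, Finset.sum_apply]
      rw [hsum fun y => y * frob K L y * frob K L (frob K L y), ← Finset.sum_sub_distrib, hnone]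
      have : ∀ i : K, algebraMap K L i * frob K L (algebraMap K L i) *
            frob K L (frob K L (algebraMap K L i)) -
          (t + algebraMap K L i) * frob K L (t + algebraMap K L i) *
            frob K L (frob K L (t + algebraMap K L i)) =
          -(t * frob K L t * frob K L (frob K L t)) -
            (t * frob K L t + t * frob K L (frob K L t) + frob K L t * frob K L (frob K L t)) *
              algebraMap K L i := by
        intro i
        simp only [map_add, AlgEquiv.commutes]
        -- Trace zero removes the `i²` term of the norm of `t + i`; the remaining constant and
        -- linear terms sum to zero over `K`.
        linear_combination (-(algebraMap K L i) ^ 2) * ht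
      rw [Finset.sum_congr rfl fun i _ => this i, Finset.sum_sub_distrib, ← Finset.mul_sum, s1]
      simp [s0]
  · intro h
    have h0 := congrFun h (some 0)
    simp only [hc, Finset.sum_apply, Pi.sub_apply, Finset.sum_sub_distrib] at h0
    have h1 : ∑ i : K, (Pi.single (some (algebraMap K L i)) 1 : Option L → K) (some 0) = 1 := by
      rw [Finset.sum_eq_single 0]
      · simp
      · intro i _ hi
        simp [eq_comm (a := (0 : L)), hi]
      · simp
    have h2 : ∑ i : K, (Pi.single (some (t + algebraMap K L i)) 1 : Option L → K) (some 0) = 0 := by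
      refine Finset.sum_eq_zero fun i _ => ?_
      have := hne 0 i
      rw [map_zero] at this
      simp [this]
    rw [h1, h2] at h0
    simp at h0
  · have hsub : (Finset.univ.filter fun p => c p ≠ 0) ⊆
        (Finset.univ.image fun i : K => some (algebraMap K L i)) ∪
          Finset.univ.image fun i : K => some (t + algebraMap K L i) := by
      intro p hp
      by_contra h
      simp only [Finset.mem_union, Finset.mem_image, Finset.mem_univ, true_and, not_or,
        not_exists] at h
      apply (Finset.mem_filter.1 hp).2
      rw [hc, Finset.sum_apply]
      refine Finset.sum_eq_zero fun i _ => ?_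
      simp [Ne.symm (h.1 i), Ne.symm (h.2 i)]
    exact (Finset.card_le_card hsub).trans ((Finset.card_union_le _ _).trans
      (add_le_add Finset.card_image_le Finset.card_image_le))

theorem card_weight_five_rat [DecidableEq K] (hL : Module.finrank K L = 3) :
    ({c | c ∈ tensorRelations K (frob K L) ∧ hammingNorm c = 5}.ncard : ℚ) =
      ((Fintype.card K : ℚ) - 3) * (Fintype.card K - 2) * (Fintype.card K - 1) *
        Fintype.card K ^ 3 * (Fintype.card K ^ 6 - 1) / 120 := by
  have hq : 2 ≤ Fintype.card K := Fintype.one_lt_card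
  have h3 := card_eq_cube (K := K) (L := L) hL
  have hL4 : 4 ≤ Fintype.card L := by
    rw [h3]
    exact le_trans (by norm_num) (Nat.pow_le_pow_left hq 3)
  have h := card_weight_five (σ := frob K L) hL4 (fun x => mem_range_of_frob_eq)
    fun x => ⟨_, algebraMap_norm_eq_frob hL x⟩
  rw [h3] at h
  -- Writing `q = 2 + k` resolves the truncated subtractions before casting to `ℚ`.
  obtain ⟨k, hk⟩ := Nat.exists_eq_add_of_le hq
  rw [hk] at h ⊢
  have hpos : 1 ≤ (2 + k) ^ 3 := Nat.one_le_pow _ _ (by omega)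
  have hd : (((2 + k) ^ 3 + 1).descFactorial 3 : ℚ) =
      ((2 + k) ^ 3 + 1) * (2 + k) ^ 3 * ((2 + k) ^ 3 - 1) := by
    simp only [Nat.descFactorial_succ, Nat.descFactorial_zero]
    rw [show (2 + k) ^ 3 + 1 - 2 = (2 + k) ^ 3 - 1 by omega, Nat.add_sub_cancel, Nat.sub_zero]
    push_cast [Nat.cast_sub hpos]
    ring
  have hk2 : ((k * k - k : ℕ) : ℚ) = k * k - k := by
    rw [Nat.cast_sub (Nat.le_mul_self k), Nat.cast_mul]
  have h' := congrArg (Nat.cast : ℕ → ℚ) h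
  rw [Nat.add_sub_cancel_left, show 2 + k - 1 = k + 1 by omega, Nat.cast_mul, Nat.cast_mul,
    Nat.cast_mul, hd, hk2] at h'
  push_cast at h' ⊢
  linear_combination h' / 120

end

/-! ### The parameters of the dual code. -/

theorem mainTheorem3 {K L : Type*} [Field K] [Fintype K] [DecidableEq K] [Field L] [Algebra K L]
    (q : ℕ) (hq : Fintype.card K = q) (hL : Module.finrank K L = 3)
    (θ : L) (hθ : IsPrimitiveRoot θ (q ^ 3 - 1)) (x : Fin (q ^ 3) ≃ L) :
    IsCodeWithParams (dualCode (ovoidCode K θ x)) (q ^ 3 - 7)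
        (if q = 2 then 9 else if q = 3 then 6 else 5) ∧
      ({c | c ∈ dualCode (ovoidCode K θ x) ∧ hammingNorm c = 5}.ncard : ℚ) =
        ((q : ℚ) - 3) * (q - 2) * (q - 1) * q ^ 3 * (q ^ 6 - 1) / 120 := by
  subst hq
  have : Fintype L := Fintype.ofEquiv _ x
  have hq2 : 2 ≤ Fintype.card K := Fintype.one_lt_card
  have hL4 : 4 ≤ Fintype.card L := by
    rw [card_eq_cube (K := K) hL]
    exact le_trans (by norm_num) (Nat.pow_le_pow_left hq2 3)
  set e := finSuccEquivLast.trans (Equiv.optionCongr x)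
  have hmem : ∀ c : Option L → K, c ∘ e ∈ dualCode (ovoidCode K θ x) ↔
      c ∈ tensorRelations K (frob K L) := comp_mem_dualCode_iff hL hθ x
  have hnorm : ∀ c : Option L → K, hammingNorm (c ∘ e) = hammingNorm c := by
    intro c
    simp only [hammingNorm, ← Fintype.card_subtype]
    exact Fintype.card_congr (e.subtypeEquiv fun j => Iff.rfl)
  have hsurj : ∀ w : Fin (Fintype.card K ^ 3 + 1) → K, ∃ c : Option L → K, w = c ∘ e :=
    fun w => ⟨w ∘ e.symm, by ext; simp⟩
  have hcomp : Function.Injective fun c : Option L → K => c ∘ e :=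
    e.surjective.injective_comp_right
  have hcount : ({c | c ∈ dualCode (ovoidCode K θ x) ∧ hammingNorm c = 5}.ncard) =
      {c | c ∈ tensorRelations K (frob K L) ∧ hammingNorm c = 5}.ncard := by
    rw [← Set.ncard_image_of_injective _ hcomp]
    congr 1
    ext w
    constructor
    · obtain ⟨c, rfl⟩ := hsurj w
      rintro ⟨h1, h2⟩
      exact ⟨c, ⟨(hmem c).1 h1, hnorm c ▸ h2⟩, rfl⟩
    · rintro ⟨c, ⟨h1, h2⟩, rfl⟩
      exact ⟨(hmem c).2 h1, (hnorm c).trans h2⟩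
  have hrat := card_weight_five_rat (K := K) (L := L) hL
  have hdim : Module.finrank K (dualCode (ovoidCode K θ x)) = Fintype.card K ^ 3 - 7 := by
    rw [ovoidCode, finrank_dualCode_span_row (linearIndependent_ovoidMatrix_row hL hθ x),
      Fintype.card_fin]
    omega
  have hweights : ∀ d, d ∈ nonzeroWeights (dualCode (ovoidCode K θ x)) ↔
      ∃ c ∈ tensorRelations K (frob K L), c ≠ 0 ∧ hammingNorm c = d := by
    intro d
    constructor
    · rintro ⟨w, h1, h2, h3⟩
      obtain ⟨c, rfl⟩ := hsurj w
      exact ⟨c, (hmem c).1 h1, by rintro rfl; exact h2 rfl, (hnorm c).symm.trans h3⟩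
    · rintro ⟨c, h1, h2, h3⟩
      exact ⟨c ∘ e, (hmem c).2 h1, fun h => h2 (hcomp h), (hnorm c).trans h3⟩
  refine ⟨⟨hdim, ?_⟩, by rw [hcount, hrat]⟩
  split_ifs with h2 h3
  · have h1 := (hmem 1).2 (one_mem_tensorRelations hL h2)
    have hnine : ∀ a : K, a ≠ 0 → hammingNorm (a • (1 : Option L → K) ∘ e) = 9 := by
      intro a ha
      simp [hammingNorm, ha, h2]
    constructor
    · exact ⟨_, h1, fun h => one_ne_zero (congrFun h 0), by simpa using hnine 1 one_ne_zero⟩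
    · rintro d ⟨w, hw, hw0, rfl⟩
      -- The dimension is `8 - 7 = 1`, so every nonzero word is a scalar multiple of the all-ones
      -- word of length 9.
      have hdim1 := hdim.trans (by rw [h2]; norm_num : Fintype.card K ^ 3 - 7 = 1)
      obtain ⟨a, ha⟩ := (finrank_eq_one_iff_of_nonzero' (⟨_, h1⟩ : dualCode (ovoidCode K θ x))
        fun h => one_ne_zero (congrFun (congrArg Subtype.val h) 0)).1 hdim1 ⟨w, hw⟩
      obtain rfl : a • (1 : Option L → K) ∘ e = w := congrArg Subtype.val ha
      rw [hnine a]
      rintro rfl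
      exact hw0 (zero_smul _ _)
  · have hempty : {c : Option L → K | c ∈ tensorRelations K (frob K L) ∧
        hammingNorm c = 5} = ∅ := by
      rw [← Set.ncard_eq_zero]
      rw [h3] at hrat
      norm_num at hrat
      exact hrat
    have hsix : ∀ c ∈ tensorRelations K (frob K L), c ≠ 0 → 6 ≤ hammingNorm c := by
      intro c hc hc0
      refine lt_of_le_of_ne (five_le_card_support hL4 hc hc0) fun h => ?_
      exact (Set.ext_iff.1 hempty c).1 ⟨hc, h.symm⟩
    constructor
    · obtain ⟨c, hc, hc0, hw⟩ := exists_tensorRelation_weight_le (K := K) hL h3.ge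
      rw [h3] at hw
      exact (hweights 6).2 ⟨c, hc, hc0, le_antisymm hw (hsix c hc hc0)⟩
    · intro d hd
      obtain ⟨c, hc, hc0, rfl⟩ := (hweights d).1 hd
      exact hsix c hc hc0
  · constructor
    · have hq4 : (4 : ℚ) ≤ Fintype.card K := by
        exact_mod_cast (by omega : 4 ≤ Fintype.card K)
      have hpos : (0 : ℚ) < ((Fintype.card K : ℚ) - 3) * (Fintype.card K - 2) *
          (Fintype.card K - 1) * Fintype.card K ^ 3 * (Fintype.card K ^ 6 - 1) / 120 := by
        have h6 : (1 : ℚ) < (Fintype.card K : ℚ) ^ 6 := one_lt_pow₀ (by linarith) (by norm_num)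
        have e1 : (0 : ℚ) < (Fintype.card K : ℚ) - 3 := by linarith
        have e2 : (0 : ℚ) < (Fintype.card K : ℚ) - 2 := by linarith
        have e3 : (0 : ℚ) < (Fintype.card K : ℚ) - 1 := by linarith
        have e4 : (0 : ℚ) < (Fintype.card K : ℚ) := by linarith
        have e5 : (0 : ℚ) < (Fintype.card K : ℚ) ^ 6 - 1 := by linarith
        positivity
      rw [← hrat] at hpos
      obtain ⟨c, hc, hw⟩ := Set.nonempty_of_ncard_ne_zero (Nat.cast_pos.1 hpos).ne'
      refine (hweights 5).2 ⟨c, hc, ?_, hw⟩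
      rintro rfl
      simp at hw
    · intro d hd
      obtain ⟨c, hc, hc0, rfl⟩ := (hweights d).1 hd
      exact five_le_card_support hL4 hc hc0
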